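/- Let $\log$ denote the binary logarithm. For every $n\in\mathbb N$ let $\varepsilon=\varepsilon(n)\in(0,1)$, let $U=U(n)$ be a finite universe, $U=\{1,\dots,u(n)\}$, and let $T=T(n)\in\mathbb N$, such that, as $n\to\infty$, $\varepsilon=o(1)$, $|U|=\omega(n\varepsilon^{-1})$ and $T=\omega(n)$. A dynamic filter with universe $U$, capacity $n$ and false-positive rate $\varepsilon$ that supports sequences of $T$ insertions and deletions and uses $h$ bits of space is a randomized data structure whose whole state is a memory of $h$ bits. It has the operations Initialize, Insert$(x)$, Delete$(x)$ and Query$(x)$ for $x\in U$, each of which may depend, in an arbitrary (measurable) way and with no bound on its running time, only on the memory, the key $x$ and a read-only infinite tape of independent fair random bits, which does not count towards the space. Consider any sequence of at most $T$ insertions and deletions, chosen independently of the tape, that starts from the empty set, inserts only absent keys, deletes only present keys, and never has more than $n$ keys present; let $S$ be the resulting key set. After it has been performed on a newly initialized filter, Query$(x)$ returns true for every $x\in S$ and every tape, and for every $x\in U\setminus S$ it returns false with probability at least $1-\varepsilon$ over the tape. Then every such dynamic filter uses $$h\ \ge\ n\log\varepsilon^{-1}+n\log e-o(n)$$ bits of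 space, where the $o(n)$ term depends only on the functions $\varepsilon,u,T$ and not on the filter. Moreover, this bound agrees up to $o(n)$ with the number $\log\binom{\lfloor n\varepsilon^{-1}\rfloor}{n}$ of bits that a fingerprint filter, which stores fingerprints of the keys from a set of $\lfloor n\varepsilon^{-1}\rfloor$ values, inherently requires: $$\log\binom{\lfloor n\varepsilon^{-1}\rfloor}{n}=n\log\varepsilon^{-1}+n\log e\pm o(n).$$ -/

import Mathlib

open Filter Asymptotics MeasureTheory

namespace DynFilter

/-- The infinite read-only tape of random bits. -/
abbrev Tape : Type := ℕ → Bool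

/-- The law of the tape: independent fair bits. -/
noncomputable def tapeLaw : Measure Tape :=
  Measure.infinitePi fun _ : ℕ => (PMF.uniformOfFintype Bool).toMeasure

/-- The contents of a memory of `h` bits. -/
abbrev Memory (h : ℕ) : Type := Fin h → Bool

/-- The two update operations on the key set. -/
inductive Op (u : ℕ) : Type
  | ins (x : Fin u) : Op u
  | del (x : Fin u) : Op u

/-- The key set after one update. -/
def Op.apply {u : ℕ} (S : Finset (Fin u)) : Op u → Finset (Fin u)
  | .ins x => insert x S
  | .del x => S.erase x

/-- An update is admissible at the key set `S` (for capacity `n`): an inserted key is new and fits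
within the capacity, a deleted key is present. -/
def Op.Admissible {u : ℕ} (n : ℕ) (S : Finset (Fin u)) : Op u → Prop
  | .ins x => x ∉ S ∧ S.card + 1 ≤ n
  | .del x => x ∈ S

/-- A sequence of updates, performed from the key set `S`, is admissible at every step. -/
def ValidFrom {u : ℕ} (n : ℕ) : Finset (Fin u) → List (Op u) → Prop
  | _, [] => True
  | S, op :: ops => op.Admissible n S ∧ ValidFrom n (op.apply S) ops

/-- The key set after a sequence of updates performed from the empty key set. -/
def keySet {u : ℕ} (ops : List (Op u)) : Finset (Fin u) := ops.foldl Op.apply ∅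

/-- A randomized data structure over the universe `Fin u` with a memory of `h` bits. Every
operation sees only the random tape, its key and the memory; there is no bound on its time.
`create` returns the initial memory. For a fixed key and memory, the outcome of an operation is a
random variable on the tape. -/
structure Algorithm (u h : ℕ) where
  create : Tape → Memory h
  insertKey : Tape → Fin u → Memory h → Memory h
  deleteKey : Tape → Fin u → Memory h → Memory h
  query : Tape → Fin u → Memory h → Bool
  measurable_create : Measurable create
  measurable_insertKey : ∀ x m, Measurable fun t => insertKey t x m
  measurable_deleteKey : ∀ x m, Measurable fun t => deleteKey t x m
  measurable_query : ∀ x m, Measurable fun t => query t x m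

/-- The effect of one update on the memory. -/
def Algorithm.step {u h : ℕ} (D : Algorithm u h) (t : Tape) (m : Memory h) : Op u → Memory h
  | .ins x => D.insertKey t x m
  | .del x => D.deleteKey t x m

/-- The memory after a sequence of updates performed on a newly created filter; the same tape is
used throughout. -/
def Algorithm.run {u h : ℕ} (D : Algorithm u h) (t : Tape) (ops : List (Op u)) : Memory h :=
  ops.foldl (D.step t) (D.create t)

/-- `D` is a dynamic filter of capacity `n` and false-positive rate `ε` that supports sequences of
up to `T` insertions and deletions: after every valid sequence of at most `T` updates, fixed
independently of the tape, a query of a present key is answered `true` whatever the tape, and a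
query of an absent key is answered `false` with probability at least `1 - ε`. -/
structure IsDynamicFilter {u h : ℕ} (D : Algorithm u h) (n : ℕ) (ε : ℝ) (T : ℕ) : Prop where
  query_present : ∀ ops : List (Op u), ValidFrom n ∅ ops → ops.length ≤ T →
    ∀ x ∈ keySet ops, ∀ t : Tape, D.query t x (D.run t ops) = true
  query_absent : ∀ ops : List (Op u), ValidFrom n ∅ ops → ops.length ≤ T →
    ∀ x ∉ keySet ops, 1 - ε ≤ tapeLaw.real {t : Tape | D.query t x (D.run t ops) = false}

end DynFilter

/-!
The bound comes from an encoding argument for a sliding window of keys. Distinct random keys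
`x 0, x 1, …` are inserted one after the other, and each key is deleted right before the `n`-th
insertion after its own. Let `A i` be the set of keys that are accepted at time `i`, when the keys
`x i, …, x (i + n - 1)` are present.

From the memory `m` at time `s + n` and all keys outside that window, the `n` keys
`x (s + n), …, x (s + 2 n - 1)` of the window can be predicted one after the other. When
`x (s + n + j)` is to be predicted, one can run the filter up to time `s + j` from the start, and
from time `s + n` to time `s + n + j` starting with `m`, as the order of deletions is the order of
insertions. The key is accepted throughout the second period, and, up to a probability `ε`, it is
not yet accepted at time `s + j`. The number of such candidates is small: for a fixed `y`, a time
`s` with `y ∉ A (s + j)` and `y ∈ A (s + n), …, A (s + n + j)` belongs to a run of acceptance whose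
length at time `s + n + j` is between `j + 1` and `n`, so that on average over many shifts `s` there
are at most `(n - j) / n * |A i| ≈ (n - j) / n * ε u` candidates (`card_shift_mul_le`,
`sum_totalWeight_le`). As the `2 ^ h` memories have to account for all the `u ^ n` windows (Kraft's
inequality, `sum_prod_predict_le`), `2 ^ h ≳ ∏ j, u / ((n - j) / n * ε u) = ε⁻ⁿ nⁿ / n!`, and
`nⁿ / n!` is `eⁿ` up to a factor `2 ^ o(n)`.

The quantitative form is `IsDynamicFilter.space_bound`. All logarithms are bounded by tangents
there, so that only the expectations of `acceptedTotal` and `earlyTotal` over the tape are needed,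
and one tape that is no worse than the average can be fixed. With `K * n` shifts for a constant
`K`, the error is `log (1 + 2 / K) + o(1)` per key, and `K` is arbitrary because `T = ω(n)`.

The comparison with fingerprints follows from
`(m + 1 - n) ^ n / n! ≤ (m choose n) ≤ m ^ n / n!` for `m = ⌊n / ε⌋`.
-/

namespace DynFilter

/-! ### Runs in a sequence of truth values -/

/-- `runLength a i` is the length of the longest block of consecutive indices ending at `i - 1`
on which `a` holds. -/
def runLength (a : ℕ → Bool) : ℕ → ℕ
  | 0 => 0
  | i + 1 => if a i then runLength a i + 1 else 0

theorem le_runLength (a : ℕ → Bool) (i k : ℕ) (h : ∀ t < k, a (i + t) = true) :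
    k ≤ runLength a (i + k) := by
  induction k with
  | zero => simp
  | succ k ih =>
    have h1 := ih fun t ht => h t (by omega)
    have h2 := h k (by omega)
    rw [← add_assoc, runLength, if_pos h2]
    omega

theorem runLength_le (a : ℕ → Bool) (i k : ℕ) (h : a i = false) :
    runLength a (i + 1 + k) ≤ k := by
  induction k with
  | zero => simp [runLength, h]
  | succ k ih =>
    rw [← add_assoc, runLength]
    split_ifs <;> omega

/-- The part of a run between its positions `j + 1` and `n` is at most the fraction `(n - j) / n`
of the run. The second summand on the left is the credit that the run in progress has built up. -/
theorem card_runLength_mul_le (a : ℕ → Bool) {n j : ℕ} (hj : j < n) (N : ℕ) :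
    n * (∑ i ∈ Finset.range N, if j < runLength a (i + 1) ∧ runLength a (i + 1) ≤ n then 1 else 0) +
        (if runLength a N ≤ j then (n - j) * runLength a N else j * (n - runLength a N)) ≤
      (n - j) * ∑ i ∈ Finset.range N, if a i then 1 else 0 := by
  induction N with
  | zero => simp [runLength]
  | succ N ih =>
    rw [Finset.sum_range_succ, Finset.sum_range_succ, mul_add, mul_add]
    by_cases ha : a N
    · have hr : runLength a (N + 1) = runLength a N + 1 := by simp [runLength, ha]
      rw [hr]
      generalize runLength a N = c at ih ⊢
      simp only [ha, if_true]
      obtain ⟨d, rfl⟩ : ∃ d, n = j + d := ⟨n - j, by omega⟩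
      rw [Nat.add_sub_cancel_left] at ih ⊢
      rcases lt_or_ge c j with h1 | h1
      · rw [if_pos h1.le] at ih
        rw [if_neg (by omega), if_pos (by omega : c + 1 ≤ j)]
        nlinarith
      · rw [if_neg (by omega : ¬ c + 1 ≤ j)]
        rcases lt_or_ge c (j + d) with h2 | h2
        · rw [if_pos ⟨by omega, by omega⟩]
          obtain ⟨e, he⟩ : ∃ e, j + d = c + 1 + e := ⟨j + d - (c + 1), by omega⟩
          have e1 : j + d - (c + 1) = e := by omega
          have e2 : j + d - c = e + 1 := by omega
          rw [e1]
          rw [e2] at ih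
          split_ifs at ih with h3
          · obtain rfl : c = j := le_antisymm h3 h1
            obtain rfl : d = 1 + e := by omega
            nlinarith
          · nlinarith
        · rw [if_neg (by omega), Nat.sub_eq_zero_of_le (by omega)]
          simp only [mul_zero, add_zero]
          have := Nat.zero_le (if c ≤ j then d * c else j * (j + d - c))
          nlinarith
    · have hr : runLength a (N + 1) = 0 := by simp [runLength, ha]
      rw [hr]
      simp [ha]
      simp at ih
      omega

/-- If `a` fails at `s + j` and holds from `s + n` to `s + n + j`, then the run through
`s + n + j` has length between `j + 1` and `n` there, so that such `s` are limited by the total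
number of indices at which `a` holds. -/
theorem card_shift_mul_le (a : ℕ → Bool) {n j : ℕ} (hj : j < n) (R : ℕ) :
    n * ((Finset.range R).filter fun s =>
        a (s + j) = false ∧ ∀ i ≤ j, a (s + n + i) = true).card ≤
      (n - j) * ((Finset.range (R + 2 * n)).filter fun i => a i = true).card := by
  have h := card_runLength_mul_le a hj (R + 2 * n)
  rw [← Finset.card_filter, ← Finset.card_filter] at h
  refine le_trans (Nat.mul_le_mul_left n ?_) ((Nat.le_add_right _ _).trans h)
  refine Finset.card_le_card_of_injOn (fun s => s + n + j) ?_ (fun x _ y _ hxy => by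
    simp only at hxy; omega)
  intro s hs
  simp only [Finset.coe_filter, Finset.mem_range, Set.mem_ofPred_eq] at hs ⊢
  obtain ⟨hs, h1, h2⟩ := hs
  refine ⟨by omega, ?_, ?_⟩
  · have := le_runLength a (s + n) (j + 1) fun t ht => h2 t (by omega)
    rw [← add_assoc] at this
    omega
  · have := runLength_le a (s + j) n h1
    rwa [show s + j + 1 + n = s + n + j + 1 by omega] at this

/-! ### Summing predictions coordinate by coordinate -/

section Predict

variable {ι U : Type*} [Fintype ι] [DecidableEq ι] [Fintype U]

theorem sum_sum_update (G : (ι → U) → ℝ) (c : ι) :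
    ∑ w, ∑ y, G (Function.update w c y) = Fintype.card U * ∑ w, G w := by
  -- `(w, y) ↦ (update w c y, w c)` is an involution
  let e : ((ι → U) × U) ≃ ((ι → U) × U) :=
    { toFun := fun p => (Function.update p.1 c p.2, p.1 c)
      invFun := fun p => (Function.update p.1 c p.2, p.1 c)
      left_inv := fun p => by simp
      right_inv := fun p => by simp }
  calc ∑ w, ∑ y, G (Function.update w c y)
      = ∑ p : (ι → U) × U, G (e p).1 := by rw [Fintype.sum_prod_type]; rfl
    _ = ∑ p : (ι → U) × U, G p.1 := Equiv.sum_comp e fun p => G p.1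
    _ = _ := by
        rw [Fintype.sum_prod_type, Finset.mul_sum]
        simp

/-- Kraft's inequality for sequential predictions: if the coordinates `c 0, c 1, …` are predicted
one after the other by sub-probability vectors `g j w`, each of which depends only on the
coordinates that are not to be predicted any more, then the predictions of a whole vector sum up
to at most `1` for every choice of the other coordinates. -/
theorem sum_prod_predict_le {n : ℕ} (g : ℕ → (ι → U) → U → ℝ) (c : ℕ → ι)
    (hg : ∀ j w y, 0 ≤ g j w y) (hg1 : ∀ j w, ∑ y, g j w y ≤ 1)
    (hc : ∀ j k, j < k → k < n → c j ≠ c k)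
    (hgc : ∀ j k, j ≤ k → k < n → ∀ w y, g j (Function.update w (c k) y) = g j w)
    (k : ℕ) (hk : k ≤ n) :
    (Fintype.card U : ℝ) ^ k * ∑ w, ∏ j ∈ Finset.range k, g j w (w (c j)) ≤
      Fintype.card (ι → U) := by
  induction k with
  | zero => simp
  | succ k ih =>
    refine le_trans ?_ (ih (by omega))
    rw [pow_succ, mul_assoc, ← sum_sum_update _ (c k)]
    gcongr with w
    calc ∑ y, ∏ j ∈ Finset.range (k + 1),
          g j (Function.update w (c k) y) (Function.update w (c k) y (c j))
        = ∑ y, (∏ j ∈ Finset.range k, g j w (w (c j))) * g k w y := by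
          refine Finset.sum_congr rfl fun y _ => ?_
          rw [Finset.prod_range_succ, hgc k k le_rfl (by omega), Function.update_self]
          congr 1
          refine Finset.prod_congr rfl fun j hj => ?_
          have hj := Finset.mem_range.1 hj
          rw [hgc j k hj.le (by omega), Function.update_of_ne (hc j k hj (by omega))]
      _ = (∏ j ∈ Finset.range k, g j w (w (c j))) * ∑ y, g k w y := by rw [Finset.mul_sum]
      _ ≤ (∏ j ∈ Finset.range k, g j w (w (c j))) * 1 :=
          mul_le_mul_of_nonneg_left (hg1 k w) (Finset.prod_nonneg fun j _ => hg j _ _)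
      _ = _ := mul_one _

end Predict

/-! ### The sliding window of keys -/

section Rolling

variable {U α : Type*} (ins del : U → α → α) (acc : U → α → Bool)

/-- The memory after the insertion of the keys `x 0, …, x (i - 1)` into the memory `m`. -/
def fill (x : ℕ → U) (m : α) : ℕ → α
  | 0 => m
  | i + 1 => ins (x i) (fill x m i)

/-- The memory after `i` rounds that start from the memory `m`; round `k` deletes `old k` and then
inserts `new k`. -/
def roll (old new : ℕ → U) (m : α) : ℕ → α
  | 0 => m
  | i + 1 => ins (new i) (del (old i) (roll old new m i))

/-- The memory at time `i` of the sliding window process: the keys are inserted in the order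
`x 0, x 1, …`, and each is deleted right before the `n`-th insertion after its own, so that
`x i, …, x (i + n - 1)` are present. -/
def window (n : ℕ) (m₀ : α) (x : ℕ → U) (i : ℕ) : α :=
  roll ins del x (fun k => x (k + n)) (fill ins x m₀ n) i

theorem fill_congr {x x' : ℕ → U} {i : ℕ} (m : α) (h : ∀ k < i, x k = x' k) :
    fill ins x m i = fill ins x' m i := by
  induction i with
  | zero => rfl
  | succ i ih => rw [fill, fill, ih fun k hk => h k (by omega), h i (by omega)]

theorem roll_congr {a a' b b' : ℕ → U} {i : ℕ} (m : α) (h : ∀ k < i, a k = a' k ∧ b k = b' k) :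
    roll ins del a b m i = roll ins del a' b' m i := by
  induction i with
  | zero => rfl
  | succ i ih =>
    rw [roll, roll, ih fun k hk => h k (by omega), (h i (by omega)).1, (h i (by omega)).2]

theorem window_congr {x x' : ℕ → U} {n i : ℕ} (m₀ : α) (h : ∀ k < n + i, x k = x' k) :
    window ins del n m₀ x i = window ins del n m₀ x' i := by
  rw [window, window, fill_congr ins m₀ fun k hk => h k (by omega)]
  exact roll_congr ins del _ fun k hk => ⟨h k (by omega), h _ (by omega)⟩

theorem roll_window (n : ℕ) (m₀ : α) (x : ℕ → U) (s i : ℕ) :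
    roll ins del (fun k => x (s + k)) (fun k => x (s + n + k)) (window ins del n m₀ x s) i =
      window ins del n m₀ x (s + i) := by
  induction i with
  | zero => rfl
  | succ i ih =>
    rw [roll, ih, ← add_assoc, window, window, roll, show s + n + i = s + i + n by omega]

/-! ### Predicting the keys of a window -/

/-- The weight with which `y` is expected to be the key `x (s + n + j)`, by someone who knows the
memory `m` at time `s + n` and all keys except `x (s + n + j), …, x (s + 2 * n - 1)`. The memories
at the times up to `s + j` and from `s + n` to `s + n + j` can be computed from these data. The key
must be accepted throughout the second period; the weight is the small number `δ` if it is already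
accepted at time `s + j`, before its insertion. -/
def keyWeight (δ : ℝ) (n s j : ℕ) (m₀ m : α) (x : ℕ → U) (y : U) : ℝ :=
  if acc y (window ins del n m₀ x (s + j)) then δ
  else if ∀ i ≤ j, acc y
      (roll ins del (fun k => x (s + n + k)) (fun k => x (s + n + n + k)) m i) = true then 1
  else 0

theorem keyWeight_nonneg {δ : ℝ} (hδ : 0 ≤ δ) (n s j : ℕ) (m₀ m : α) (x : ℕ → U) (y : U) :
    0 ≤ keyWeight ins del acc δ n s j m₀ m x y := by
  unfold keyWeight
  split_ifs <;> positivity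

theorem keyWeight_congr (δ : ℝ) {n s j : ℕ} (hj : j < n) (m₀ m : α) {x x' : ℕ → U}
    (h : ∀ l < s + 3 * n, l < s + n + j ∨ s + n + n ≤ l → x l = x' l) :
    keyWeight ins del acc δ n s j m₀ m x = keyWeight ins del acc δ n s j m₀ m x' := by
  funext y
  have h1 : window ins del n m₀ x (s + j) = window ins del n m₀ x' (s + j) :=
    window_congr ins del m₀ fun k hk => h k (by omega) (by omega)
  have h2 : ∀ i ≤ j,
      roll ins del (fun k => x (s + n + k)) (fun k => x (s + n + n + k)) m i =
        roll ins del (fun k => x' (s + n + k)) (fun k => x' (s + n + n + k)) m i := fun i hi =>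
    roll_congr ins del m fun k hk => ⟨h _ (by omega) (by omega), h _ (by omega) (by omega)⟩
  unfold keyWeight
  rw [h1]
  congr 1
  have : (∀ i ≤ j, acc y
      (roll ins del (fun k => x (s + n + k)) (fun k => x (s + n + n + k)) m i) = true) ↔
    (∀ i ≤ j, acc y
      (roll ins del (fun k => x' (s + n + k)) (fun k => x' (s + n + n + k)) m i) = true) :=
    forall₂_congr fun i hi => by rw [h2 i hi]
  simp only [this]

/-- A vector of `L` keys as a sequence. Indices are taken modulo `L`, but only those below `L`
matter. -/
def extend {L : ℕ} [NeZero L] (w : Fin L → U) (k : ℕ) : U := w (Fin.ofNat L k)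

theorem ofNat_injOn {L : ℕ} [NeZero L] {j k : ℕ} (hj : j < L) (hk : k < L) :
    Fin.ofNat L j = Fin.ofNat L k ↔ j = k := by
  rw [Fin.ext_iff]
  simp [Nat.mod_eq_of_lt hj, Nat.mod_eq_of_lt hk]

theorem extend_update {L : ℕ} [NeZero L] (w : Fin L → U) {c l : ℕ} (hc : c < L) (hl : l < L)
    (h : l ≠ c) (y : U) : extend (Function.update w (Fin.ofNat L c) y) l = extend w l := by
  rw [extend, Function.update_of_ne (by rwa [ne_eq, ofNat_injOn hl hc]), extend]

variable [Fintype U]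

/-- The total weight that `keyWeight` distributes. -/
def totalWeight (δ : ℝ) (n s j : ℕ) (m₀ m : α) (x : ℕ → U) : ℝ :=
  ∑ y, keyWeight ins del acc δ n s j m₀ m x y

/-- The predicted probability of the keys `x (s + n), …, x (s + 2 * n - 1)`, given the memory `m`
at time `s + n` and all other keys. -/
noncomputable def predictedProb (δ : ℝ) (n s : ℕ) (m₀ m : α) (x : ℕ → U) : ℝ :=
  ∏ j ∈ Finset.range n, keyWeight ins del acc δ n s j m₀ m x (x (s + n + j)) /
    totalWeight ins del acc δ n s j m₀ m x

theorem predictedProb_nonneg {δ : ℝ} (hδ : 0 ≤ δ) (n s : ℕ) (m₀ m : α) (x : ℕ → U) :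
    0 ≤ predictedProb ins del acc δ n s m₀ m x :=
  Finset.prod_nonneg fun _ _ => div_nonneg (keyWeight_nonneg ins del acc hδ ..)
    (Finset.sum_nonneg fun _ _ => keyWeight_nonneg ins del acc hδ ..)

theorem sum_predictedProb_le {δ : ℝ} (hδ : 0 ≤ δ) {n s L : ℕ} [NeZero L] (hL : s + 3 * n ≤ L)
    (m₀ m : α) :
    (Fintype.card U : ℝ) ^ n *
        ∑ w : Fin L → U, predictedProb ins del acc δ n s m₀ m (extend w) ≤
      (Fintype.card U : ℝ) ^ L := by
  rcases Nat.eq_zero_or_pos n with rfl | hn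
  · simp [predictedProb]
  have key := sum_prod_predict_le (ι := Fin L) (U := U) (n := n)
    (fun j w y => if j < n then keyWeight ins del acc δ n s j m₀ m (extend w) y /
      totalWeight ins del acc δ n s j m₀ m (extend w) else 0)
    (fun k => Fin.ofNat L (s + n + k)) ?_ ?_ ?_ ?_ n le_rfl
  · simp only [Fintype.card_fun, Fintype.card_fin, Nat.cast_pow] at key
    refine le_of_eq_of_le ?_ key
    congr 1
    refine Finset.sum_congr rfl fun w _ => Finset.prod_congr rfl fun j hj => ?_
    rw [if_pos (Finset.mem_range.1 hj)]
    rfl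
  · intro j w y
    split_ifs
    · exact div_nonneg (keyWeight_nonneg ins del acc hδ ..)
        (Finset.sum_nonneg fun y _ => keyWeight_nonneg ins del acc hδ ..)
    · exact le_rfl
  · intro j w
    split_ifs
    · rw [← Finset.sum_div]
      exact div_self_le_one _
    · simp
  · intro j k hjk hk
    rw [ne_eq, ofNat_injOn (by omega) (by omega)]
    omega
  · intro j k hjk hk w y
    have : keyWeight ins del acc δ n s j m₀ m
        (extend (Function.update w (Fin.ofNat L (s + n + k)) y)) =
        keyWeight ins del acc δ n s j m₀ m (extend w) :=
      keyWeight_congr ins del acc δ (by omega) m₀ m fun l hl h =>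
        extend_update w (by omega) (by omega) (by omega) y
    simp only [totalWeight, this]

/-- The number of keys that are accepted at the times below `N`, summed over these times. -/
def acceptedTotal (n N : ℕ) (m₀ : α) (x : ℕ → U) : ℕ :=
  ∑ i ∈ Finset.range N, (Finset.univ.filter fun y => acc y (window ins del n m₀ x i) = true).card

/-- The number of times below `N` at which the next key to be inserted is already accepted. -/
def earlyTotal (n N : ℕ) (m₀ : α) (x : ℕ → U) : ℕ :=
  ((Finset.range N).filter fun i => acc (x (i + n)) (window ins del n m₀ x i) = true).card

/-- The stationarity argument: on average over the shifts `s`, about the fraction `(n - j) / n` of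
the accepted keys have a weight that is not small. -/
theorem sum_totalWeight_le {δ : ℝ} (hδ : 0 ≤ δ) {n j : ℕ} (hj : j < n) (R : ℕ) (m₀ : α)
    (x : ℕ → U) :
    ∑ s ∈ Finset.range R,
        totalWeight ins del acc δ n s j m₀ (window ins del n m₀ x (s + n)) x ≤
      (((n : ℝ) - j) / n + δ) * acceptedTotal ins del acc n (R + 2 * n) m₀ x := by
  have hn : (0 : ℝ) < n := by exact_mod_cast (show 0 < n by omega)
  set a : U → ℕ → Bool := fun y i => acc y (window ins del n m₀ x i) with ha
  have hacc : (acceptedTotal ins del acc n (R + 2 * n) m₀ x : ℝ) =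
      ∑ y, (((Finset.range (R + 2 * n)).filter fun i => a y i = true).card : ℝ) := by
    unfold acceptedTotal
    push_cast [Finset.card_filter]
    exact Finset.sum_comm
  rw [hacc, Finset.mul_sum]
  simp only [totalWeight]
  rw [Finset.sum_comm]
  refine Finset.sum_le_sum fun y _ => ?_
  have h1 : ∀ s, keyWeight ins del acc δ n s j m₀ (window ins del n m₀ x (s + n)) x y =
      (if a y (s + j) = false ∧ ∀ i ≤ j, a y (s + n + i) = true then 1 else 0) +
        δ * (if a y (s + j) = true then 1 else 0) := by
    intro s
    unfold keyWeight
    simp only [roll_window]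
    change (if a y (s + j) = true then δ
      else if ∀ i ≤ j, a y (s + n + i) = true then 1 else 0) = _
    cases a y (s + j) <;> simp
  simp only [h1]
  rw [Finset.sum_add_distrib, ← Finset.mul_sum, add_mul]
  refine add_le_add ?_ (mul_le_mul_of_nonneg_left ?_ hδ)
  · rw [← Finset.natCast_card_filter, div_mul_eq_mul_div, le_div_iff₀ hn]
    have := card_shift_mul_le (a y) hj R
    have h2 : ((n * ((Finset.range R).filter fun s =>
        a y (s + j) = false ∧ ∀ i ≤ j, a y (s + n + i) = true).card : ℕ) : ℝ) ≤
      ((n - j) * ((Finset.range (R + 2 * n)).filter fun i => a y i = true).card : ℕ) := by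
      exact_mod_cast this
    push_cast [Nat.cast_sub hj.le] at h2
    linarith
  · rw [← Finset.natCast_card_filter]
    refine Nat.cast_le.2 (Finset.card_le_card_of_injOn (fun s => s + j) ?_
      fun x _ y _ hxy => by simp only at hxy; omega)
    intro s hs
    simp only [Finset.coe_filter, Finset.mem_range, Set.mem_ofPred_eq] at hs ⊢
    exact ⟨by omega, hs.2⟩

theorem log_le_of_pos {b x : ℝ} (hb : 0 < b) (hx : 0 < x) :
    Real.log x ≤ Real.log b + x / b - 1 := by
  have := Real.log_le_sub_one_of_pos (div_pos hx hb)
  rw [Real.log_div hx.ne' hb.ne'] at this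
  linarith

/-- A lower bound for the predicted probability of the actual keys. The logarithm of `totalWeight`
is replaced by its tangent at `b j`, which makes the bound linear in `totalWeight`. -/
theorem le_log_predictedProb {δ : ℝ} (hδ : 0 < δ) {n s : ℕ} (m₀ : α) (x : ℕ → U)
    (hx : ∀ i < s + 2 * n, ∀ k, i ≤ k → k < i + n → acc (x k) (window ins del n m₀ x i) = true)
    (b : ℕ → ℝ) (hb : ∀ j, j < n → 0 < b j) :
    0 < predictedProb ins del acc δ n s m₀ (window ins del n m₀ x (s + n)) x ∧
    ∑ j ∈ Finset.range n, ((if acc (x (s + n + j)) (window ins del n m₀ x (s + j)) = true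
          then Real.log δ else 0) - Real.log (b j) -
        totalWeight ins del acc δ n s j m₀ (window ins del n m₀ x (s + n)) x / b j + 1) ≤
      Real.log (predictedProb ins del acc δ n s m₀ (window ins del n m₀ x (s + n)) x) := by
  set m := window ins del n m₀ x (s + n) with hm
  have hw : ∀ j < n, keyWeight ins del acc δ n s j m₀ m x (x (s + n + j)) =
      if acc (x (s + n + j)) (window ins del n m₀ x (s + j)) = true then δ else 1 := by
    intro j hj
    unfold keyWeight
    rw [hm]
    simp only [roll_window]
    rw [if_pos fun i hi => hx (s + n + i) (by omega) _ (by omega) (by omega)]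
  have hpos : ∀ j < n, 0 < keyWeight ins del acc δ n s j m₀ m x (x (s + n + j)) := by
    intro j hj
    rw [hw j hj]
    split_ifs <;> positivity
  have htot : ∀ j < n, 0 < totalWeight ins del acc δ n s j m₀ m x := fun j hj =>
    (hpos j hj).trans_le (Finset.single_le_sum
      (f := fun y => keyWeight ins del acc δ n s j m₀ m x y)
      (fun y _ => keyWeight_nonneg ins del acc hδ.le ..) (Finset.mem_univ _))
  refine ⟨Finset.prod_pos fun j hj =>
    div_pos (hpos j (Finset.mem_range.1 hj)) (htot j (Finset.mem_range.1 hj)), ?_⟩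
  unfold predictedProb
  rw [Real.log_prod fun j hj =>
    (div_pos (hpos j (Finset.mem_range.1 hj)) (htot j (Finset.mem_range.1 hj))).ne']
  refine Finset.sum_le_sum fun j hj => ?_
  have hj := Finset.mem_range.1 hj
  rw [Real.log_div (hpos j hj).ne' (htot j hj).ne', hw j hj]
  have := log_le_of_pos (hb j hj) (htot j hj)
  split_ifs
  · linarith
  · rw [Real.log_one]; linarith

/-- The space bound for one tape. For a family `E` of key vectors, for each of which the accepted
sets contain the present keys, the number of memories is bounded below in terms of the averages of
`acceptedTotal` and `earlyTotal`. -/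
theorem le_log_card [Fintype α] {δ B : ℝ} (hδ : 0 < δ) (hδ1 : δ ≤ 1) (hB : 0 < B) {n R L : ℕ}
    [NeZero L] (hL : L = R + 3 * n) (m₀ : α) (E : Finset (Fin L → U)) (hE : E.Nonempty)
    (hacc : ∀ w ∈ E, ∀ i < R + 2 * n, ∀ k, i ≤ k → k < i + n →
      acc (extend w k) (window ins del n m₀ (extend w) i) = true) :
    ∑ w ∈ E, (n * earlyTotal ins del acc n (R + 2 * n) m₀ (extend w) * Real.log δ -
        n * acceptedTotal ins del acc n (R + 2 * n) m₀ (extend w) / B) +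
      R * E.card * (n - ∑ j ∈ Finset.range n, Real.log ((((n : ℝ) - j) / n + δ) * B)) ≤
    R * E.card * (Real.log (Fintype.card α) + L * Real.log (Fintype.card U)
      - n * Real.log (Fintype.card U) - Real.log E.card) := by
  obtain ⟨w₀, hw₀⟩ := hE
  have hEpos : (0 : ℝ) < E.card := by exact_mod_cast Finset.card_pos.2 ⟨w₀, hw₀⟩
  have hU : (0 : ℝ) < Fintype.card U := by
    exact_mod_cast Fintype.card_pos_iff.2 ⟨w₀ 0⟩
  have hα : (0 : ℝ) < Fintype.card α := by exact_mod_cast Fintype.card_pos_iff.2 ⟨m₀⟩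
  set b : ℕ → ℝ := fun j => (((n : ℝ) - j) / n + δ) * B with hbdef
  have hb : ∀ j, j < n → 0 < b j := fun j hj => by
    have : (j : ℝ) < n := by exact_mod_cast hj
    have h1 : (0 : ℝ) ≤ ((n : ℝ) - j) / n := div_nonneg (by linarith) (by positivity)
    positivity
  set Q : (Fin L → U) → ℕ → ℝ := fun w s => predictedProb ins del acc δ n s m₀
    (window ins del n m₀ (extend w) (s + n)) (extend w) with hQ
  -- the upper bound, from Kraft's inequality
  set C : ℝ := Fintype.card α * (Fintype.card U : ℝ) ^ L / (Fintype.card U : ℝ) ^ n / E.card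
    with hC
  have hCpos : 0 < C := by positivity
  have hlogC : Real.log C = Real.log (Fintype.card α) + L * Real.log (Fintype.card U)
      - n * Real.log (Fintype.card U) - Real.log E.card := by
    rw [hC, Real.log_div (by positivity) hEpos.ne', Real.log_div (by positivity) (by positivity),
      Real.log_mul hα.ne' (by positivity), Real.log_pow, Real.log_pow]
  have hsumQ : ∀ s < R, ∑ w ∈ E, Q w s ≤ C * E.card := by
    intro s hs
    calc ∑ w ∈ E, Q w s ≤ ∑ w, Q w s :=
          Finset.sum_le_sum_of_subset_of_nonneg (Finset.subset_univ _) fun w _ _ =>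
            predictedProb_nonneg ins del acc hδ.le ..
      _ ≤ ∑ w : Fin L → U, ∑ m, predictedProb ins del acc δ n s m₀ m (extend w) :=
          Finset.sum_le_sum fun w _ => Finset.single_le_sum
            (f := fun m => predictedProb ins del acc δ n s m₀ m (extend w))
            (fun m _ => predictedProb_nonneg ins del acc hδ.le ..) (Finset.mem_univ _)
      _ = ∑ m, ∑ w : Fin L → U, predictedProb ins del acc δ n s m₀ m (extend w) :=
          Finset.sum_comm
      _ ≤ ∑ m : α, (Fintype.card U : ℝ) ^ L / (Fintype.card U : ℝ) ^ n := by
          refine Finset.sum_le_sum fun m _ => ?_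
          rw [le_div_iff₀ (by positivity), mul_comm]
          exact sum_predictedProb_le ins del acc hδ.le (by omega) m₀ m
      _ = C * E.card := by
          rw [Finset.sum_const, Finset.card_univ, nsmul_eq_mul, hC, div_mul_cancel₀ _ hEpos.ne',
            mul_div_assoc]
  have hlower : ∀ w ∈ E, ∀ s < R, 0 < Q w s ∧ _ ≤ Real.log (Q w s) := fun w hw s hs =>
    le_log_predictedProb ins del acc hδ m₀ (extend w)
      (fun i hi k hk hk' => hacc w hw i (by omega) k hk hk') b hb
  have hupper : ∑ w ∈ E, ∑ s ∈ Finset.range R, Real.log (Q w s) ≤ R * E.card * Real.log C := by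
    rw [Finset.sum_comm]
    calc ∑ s ∈ Finset.range R, ∑ w ∈ E, Real.log (Q w s)
        ≤ ∑ s ∈ Finset.range R, ∑ w ∈ E, (Real.log C + Q w s / C - 1) :=
          Finset.sum_le_sum fun s hs => Finset.sum_le_sum fun w hw =>
            log_le_of_pos hCpos (hlower w hw s (Finset.mem_range.1 hs)).1
      _ ≤ ∑ s ∈ Finset.range R, E.card * Real.log C := by
          refine Finset.sum_le_sum fun s hs => ?_
          have h1 := hsumQ s (Finset.mem_range.1 hs)
          rw [Finset.sum_sub_distrib, Finset.sum_add_distrib, ← Finset.sum_div]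
          simp only [Finset.sum_const, nsmul_eq_mul, mul_one]
          have h2 : (∑ w ∈ E, Q w s) / C ≤ E.card := by
            rw [div_le_iff₀ hCpos]; linarith
          linarith
      _ = R * E.card * Real.log C := by
          rw [Finset.sum_const, Finset.card_range, nsmul_eq_mul, mul_assoc]
  rw [← hlogC]
  refine le_trans ?_ hupper
  have hsplit : (R : ℝ) * E.card * (n - ∑ j ∈ Finset.range n, Real.log (b j)) =
      ∑ w ∈ E, R * (n - ∑ j ∈ Finset.range n, Real.log (b j)) := by
    rw [Finset.sum_const, nsmul_eq_mul]; ring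
  rw [hsplit, ← Finset.sum_add_distrib]
  refine Finset.sum_le_sum fun w hw => ?_
  refine le_trans ?_ (Finset.sum_le_sum fun s hs => (hlower w hw s (Finset.mem_range.1 hs)).2)
  rw [Finset.sum_comm]
  set x := extend w
  set X : ℝ := ((acceptedTotal ins del acc n (R + 2 * n) m₀ x : ℕ) : ℝ) with hX
  set Y : ℝ := ((earlyTotal ins del acc n (R + 2 * n) m₀ x : ℕ) : ℝ) with hY
  have hterm : ∀ j ∈ Finset.range n, Y * Real.log δ - X / B + R * (1 - Real.log (b j)) ≤
      ∑ s ∈ Finset.range R,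
        ((if acc (x (s + n + j)) (window ins del n m₀ x (s + j)) = true
          then Real.log δ else 0) - Real.log (b j) -
        totalWeight ins del acc δ n s j m₀ (window ins del n m₀ x (s + n)) x / b j + 1) := by
    intro j hj
    have hj := Finset.mem_range.1 hj
    rw [Finset.sum_add_distrib, Finset.sum_sub_distrib, Finset.sum_sub_distrib, ← Finset.sum_div]
    simp only [Finset.sum_const, Finset.card_range, nsmul_eq_mul, mul_one]
    have h1 : (∑ s ∈ Finset.range R,
        totalWeight ins del acc δ n s j m₀ (window ins del n m₀ x (s + n)) x) / b j ≤ X / B := by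
      rw [div_le_iff₀ (hb j hj)]
      refine (sum_totalWeight_le ins del acc hδ.le hj R m₀ x).trans (le_of_eq ?_)
      rw [hbdef, hX]
      field_simp
    have h2 : Y * Real.log δ ≤ ∑ s ∈ Finset.range R,
        (if acc (x (s + n + j)) (window ins del n m₀ x (s + j)) = true
          then Real.log δ else 0) := by
      rw [← Finset.sum_filter, Finset.sum_const, nsmul_eq_mul]
      refine mul_le_mul_of_nonpos_right ?_ (Real.log_nonpos hδ.le hδ1)
      refine Nat.cast_le.2 (Finset.card_le_card_of_injOn (fun s => s + j) ?_
        fun x _ y _ hxy => by simp only at hxy; omega)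
      intro s hs
      simp only [Finset.coe_filter, Finset.mem_range, Set.mem_ofPred_eq] at hs ⊢
      refine ⟨by omega, ?_⟩
      rw [show s + j + n = s + n + j by omega]
      exact hs.2
    linarith
  refine le_of_eq_of_le ?_ (Finset.sum_le_sum hterm)
  rw [Finset.sum_add_distrib, ← Finset.mul_sum, Finset.sum_sub_distrib (f := fun _ => (1 : ℝ))]
  simp only [Finset.sum_const, Finset.card_range, nsmul_eq_mul, mul_one]
  ring

end Rolling

/-! ### The sliding window as a valid sequence of updates -/

section Ops

variable {u : ℕ}

/-- The insertions of `x 0, …, x (i - 1)`. -/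
def fillOps (x : ℕ → Fin u) : ℕ → List (Op u)
  | 0 => []
  | i + 1 => fillOps x i ++ [.ins (x i)]

/-- The updates that lead to time `i` of the sliding window process. -/
def windowOps (n : ℕ) (x : ℕ → Fin u) : ℕ → List (Op u)
  | 0 => fillOps x n
  | i + 1 => windowOps n x i ++ [.del (x i), .ins (x (i + n))]

theorem validFrom_append (n : ℕ) (S : Finset (Fin u)) (l l' : List (Op u)) :
    ValidFrom n S (l ++ l') ↔ ValidFrom n S l ∧ ValidFrom n (l.foldl Op.apply S) l' := by
  induction l generalizing S with
  | nil => simp [ValidFrom]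
  | cons op l ih => simp [ValidFrom, ih, and_assoc]

theorem length_fillOps (x : ℕ → Fin u) (i : ℕ) : (fillOps x i).length = i := by
  induction i with
  | zero => rfl
  | succ i ih => simp [fillOps, ih]

theorem length_windowOps (n : ℕ) (x : ℕ → Fin u) (i : ℕ) :
    (windowOps n x i).length = n + 2 * i := by
  induction i with
  | zero => simp [windowOps, length_fillOps]
  | succ i ih => simp [windowOps, ih]; ring

theorem keySet_fillOps (x : ℕ → Fin u) (i : ℕ) :
    keySet (fillOps x i) = (Finset.range i).image x := by
  induction i with
  | zero => rfl
  | succ i ih =>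
    rw [keySet, fillOps, List.foldl_append, ← keySet, ih, Finset.range_add_one,
      Finset.image_insert]
    rfl

variable {n L : ℕ} {x : ℕ → Fin u}

theorem validFrom_fillOps (hx : ∀ j < L, ∀ k < L, x j = x k → j = k) {i : ℕ} (hi : i ≤ L)
    (hin : i ≤ n) : ValidFrom n ∅ (fillOps x i) := by
  induction i with
  | zero => trivial
  | succ i ih =>
    rw [fillOps, validFrom_append, ← keySet, keySet_fillOps]
    refine ⟨ih (by omega) (by omega), ⟨?_, ?_⟩, trivial⟩
    · intro h
      obtain ⟨k, hk, hki⟩ := Finset.mem_image.1 h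
      have hk := Finset.mem_range.1 hk
      have := hx k (by omega) i (by omega) hki
      omega
    · have := Finset.card_image_le (s := Finset.range i) (f := x)
      rw [Finset.card_range] at this
      omega

theorem erase_image_Ico (hx : ∀ j < L, ∀ k < L, x j = x k → j = k) {i : ℕ} (hi : i + n ≤ L) :
    ((Finset.Ico i (i + n)).image x).erase (x i) = (Finset.Ico (i + 1) (i + n)).image x := by
  ext y
  simp only [Finset.mem_erase, Finset.mem_image, Finset.mem_Ico]
  constructor
  · rintro ⟨hy, k, hk, rfl⟩
    refine ⟨k, ⟨?_, hk.2⟩, rfl⟩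
    rcases hk.1.eq_or_lt with rfl | h
    · exact absurd rfl hy
    · exact h
  · rintro ⟨k, hk, rfl⟩
    refine ⟨fun h => ?_, k, ⟨by omega, hk.2⟩, rfl⟩
    have := hx k (by omega) i (by omega) h
    omega

theorem keySet_windowOps (hn : 0 < n) (hx : ∀ j < L, ∀ k < L, x j = x k → j = k) {i : ℕ}
    (hi : i + n ≤ L) : keySet (windowOps n x i) = (Finset.Ico i (i + n)).image x := by
  induction i with
  | zero => rw [windowOps, keySet_fillOps, Finset.range_eq_Ico, zero_add]
  | succ i ih =>
    rw [keySet, windowOps, List.foldl_append, ← keySet, ih (by omega)]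
    change insert (x (i + n)) (((Finset.Ico i (i + n)).image x).erase (x i)) = _
    rw [erase_image_Ico hx (by omega), ← Finset.image_insert,
      show i + 1 + n = i + n + 1 by omega, ← Finset.insert_Ico_right_eq_Ico_add_one (by omega)]

theorem validFrom_windowOps (hn : 0 < n) (hx : ∀ j < L, ∀ k < L, x j = x k → j = k) {i : ℕ}
    (hi : i + n ≤ L) : ValidFrom n ∅ (windowOps n x i) := by
  induction i with
  | zero => exact validFrom_fillOps hx (by omega) le_rfl
  | succ i ih =>
    rw [windowOps, validFrom_append, ← keySet, keySet_windowOps hn hx (by omega)]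
    refine ⟨ih (by omega), ?_, ⟨?_, ?_⟩, trivial⟩
    · exact Finset.mem_image_of_mem x (Finset.mem_Ico.2 ⟨le_rfl, by omega⟩)
    · change x (i + n) ∉ ((Finset.Ico i (i + n)).image x).erase (x i)
      rw [erase_image_Ico hx (by omega)]
      intro h
      obtain ⟨k, hk, hki⟩ := Finset.mem_image.1 h
      have hk := Finset.mem_Ico.1 hk
      have := hx k (by omega) (i + n) (by omega) hki
      omega
    · change (((Finset.Ico i (i + n)).image x).erase (x i)).card + 1 ≤ n
      rw [erase_image_Ico hx (by omega)]
      have := Finset.card_image_le (s := Finset.Ico (i + 1) (i + n)) (f := x)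
      rw [Nat.card_Ico] at this
      omega

variable {h : ℕ} (D : Algorithm u h)

theorem run_fillOps (t : Tape) (x : ℕ → Fin u) (i : ℕ) :
    D.run t (fillOps x i) = fill (D.insertKey t) x (D.create t) i := by
  induction i with
  | zero => rfl
  | succ i ih => rw [Algorithm.run, fillOps, List.foldl_append, ← Algorithm.run, ih]; rfl

theorem run_windowOps (t : Tape) (n : ℕ) (x : ℕ → Fin u) (i : ℕ) :
    D.run t (windowOps n x i) = window (D.insertKey t) (D.deleteKey t) n (D.create t) x i := by
  induction i with
  | zero => exact run_fillOps D t x n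
  | succ i ih =>
    rw [Algorithm.run, windowOps, List.foldl_append, ← Algorithm.run, ih]
    rfl

/-! ### Averaging over the tape -/

instance : IsProbabilityMeasure tapeLaw := by
  unfold tapeLaw
  infer_instance

theorem measurable_comp_memory {β : Type*} [MeasurableSpace β] {f : Tape → Memory h → β}
    {g : Tape → Memory h} (hf : ∀ m, Measurable fun t => f t m) (hg : Measurable g) :
    Measurable fun t => f t (g t) := by
  have : Measurable fun p : Tape × Memory h => f p.1 p.2 := measurable_from_prod_countable_left hf
  exact this.comp (measurable_id.prodMk hg)

theorem measurable_run (ops : List (Op u)) : Measurable fun t => D.run t ops := by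
  induction ops using List.reverseRecOn with
  | nil => exact D.measurable_create
  | append_singleton ops op ih =>
    have : (fun t => D.run t (ops ++ [op])) = fun t => D.step t (D.run t ops) op := by
      funext t
      simp [Algorithm.run]
    rw [this]
    cases op with
    | ins x => exact measurable_comp_memory (D.measurable_insertKey x) ih
    | del x => exact measurable_comp_memory (D.measurable_deleteKey x) ih

/-- The tapes with which the key `y` is accepted after the updates `ops`. -/
def acceptEvent (ops : List (Op u)) (y : Fin u) : Set Tape :=
  {t | D.query t y (D.run t ops) = true}

theorem measurableSet_acceptEvent (ops : List (Op u)) (y : Fin u) :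
    MeasurableSet (acceptEvent D ops y) :=
  measurable_comp_memory (D.measurable_query y) (measurable_run D ops)
    (measurableSet_singleton true)

theorem tapeLaw_acceptEvent_le {ε : ℝ} {T : ℕ} (hD : IsDynamicFilter D n ε T)
    {ops : List (Op u)} (hv : ValidFrom n ∅ ops) (hl : ops.length ≤ T) {y : Fin u}
    (hy : y ∉ keySet ops) : tapeLaw.real (acceptEvent D ops y) ≤ ε := by
  have h1 := hD.query_absent ops hv hl y hy
  have h2 : {t | D.query t y (D.run t ops) = false} = (acceptEvent D ops y)ᶜ := by
    ext t
    simp [acceptEvent]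
  rw [h2, probReal_compl_eq_one_sub (measurableSet_acceptEvent D ops y)] at h1
  linarith

theorem acceptedTotal_eq (N : ℕ) (x : ℕ → Fin u) (t : Tape) :
    (acceptedTotal (D.insertKey t) (D.deleteKey t) (D.query t) n N (D.create t) x : ℝ) =
      ∑ i ∈ Finset.range N, ∑ y, (acceptEvent D (windowOps n x i) y).indicator 1 t := by
  unfold acceptedTotal
  push_cast [Finset.card_filter]
  refine Finset.sum_congr rfl fun i _ => Finset.sum_congr rfl fun y _ => ?_
  simp only [Set.indicator, acceptEvent, Set.mem_ofPred_eq, run_windowOps, Pi.one_apply]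

theorem earlyTotal_eq (N : ℕ) (x : ℕ → Fin u) (t : Tape) :
    (earlyTotal (D.insertKey t) (D.deleteKey t) (D.query t) n N (D.create t) x : ℝ) =
      ∑ i ∈ Finset.range N, (acceptEvent D (windowOps n x i) (x (i + n))).indicator 1 t := by
  unfold earlyTotal
  push_cast [Finset.card_filter]
  refine Finset.sum_congr rfl fun i _ => ?_
  simp only [Set.indicator, acceptEvent, Set.mem_ofPred_eq, run_windowOps, Pi.one_apply]

theorem integrable_indicator_acceptEvent (ops : List (Op u)) (y : Fin u) :
    Integrable ((acceptEvent D ops y).indicator (1 : Tape → ℝ)) tapeLaw :=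
  (integrable_const (1 : ℝ)).indicator (measurableSet_acceptEvent D ops y)

theorem integrable_acceptedTotal (n N : ℕ) (x : ℕ → Fin u) :
    Integrable (fun t => (acceptedTotal (D.insertKey t) (D.deleteKey t) (D.query t) n N
      (D.create t) x : ℝ)) tapeLaw := by
  simp only [acceptedTotal_eq]
  exact integrable_finsetSum _ fun i _ => integrable_finsetSum _ fun y _ =>
    integrable_indicator_acceptEvent D _ y

theorem integrable_earlyTotal (n N : ℕ) (x : ℕ → Fin u) :
    Integrable (fun t => (earlyTotal (D.insertKey t) (D.deleteKey t) (D.query t) n N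
      (D.create t) x : ℝ)) tapeLaw := by
  simp only [earlyTotal_eq]
  exact integrable_finsetSum _ fun i _ => integrable_indicator_acceptEvent D _ _

theorem integral_acceptedTotal_le {ε : ℝ} {T N : ℕ} (hε : 0 ≤ ε) (hD : IsDynamicFilter D n ε T)
    (hn : 0 < n) (hx : ∀ j < N + n, ∀ k < N + n, x j = x k → j = k) (hT : n + 2 * N ≤ T) :
    ∫ t, (acceptedTotal (D.insertKey t) (D.deleteKey t) (D.query t) n N (D.create t) x : ℝ)
      ∂tapeLaw ≤ N * (ε * u + n) := by
  simp only [acceptedTotal_eq]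
  rw [integral_finsetSum _ fun i _ => integrable_finsetSum _ fun y _ =>
    integrable_indicator_acceptEvent D _ y]
  calc _ ≤ ∑ i ∈ Finset.range N, (ε * u + n) := ?_
    _ = _ := by rw [Finset.sum_const, Finset.card_range, nsmul_eq_mul]
  refine Finset.sum_le_sum fun i hi => ?_
  have hi := Finset.mem_range.1 hi
  rw [integral_finsetSum _ fun y _ => integrable_indicator_acceptEvent D _ y]
  have hks := keySet_windowOps hn hx (show i + n ≤ N + n by omega)
  calc _ ≤ ∑ y : Fin u, (ε + if y ∈ keySet (windowOps n x i) then 1 else 0) := ?_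
    _ ≤ _ := ?_
  · refine Finset.sum_le_sum fun y _ => ?_
    rw [integral_indicator_one (measurableSet_acceptEvent D _ _)]
    split_ifs with hy
    · have : tapeLaw.real (acceptEvent D (windowOps n x i) y) ≤ 1 := measureReal_le_one
      linarith
    · rw [add_zero]
      exact tapeLaw_acceptEvent_le D hD (validFrom_windowOps hn hx (by omega))
        (by rw [length_windowOps]; omega) hy
  · rw [Finset.sum_add_distrib, Finset.sum_const, Finset.card_univ, Fintype.card_fin,
      nsmul_eq_mul, ← Finset.natCast_card_filter, mul_comm ε, Finset.filter_univ_mem]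
    have h1 := Finset.card_image_le (s := Finset.Ico i (i + n)) (f := x)
    rw [← hks, Nat.card_Ico, Nat.add_sub_cancel_left] at h1
    have h2 : ((keySet (windowOps n x i)).card : ℝ) ≤ n := by exact_mod_cast h1
    linarith

theorem integral_earlyTotal_le {ε : ℝ} {T N : ℕ} (hD : IsDynamicFilter D n ε T)
    (hn : 0 < n) (hx : ∀ j < N + n, ∀ k < N + n, x j = x k → j = k) (hT : n + 2 * N ≤ T) :
    ∫ t, (earlyTotal (D.insertKey t) (D.deleteKey t) (D.query t) n N (D.create t) x : ℝ)
      ∂tapeLaw ≤ N * ε := by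
  simp only [earlyTotal_eq]
  rw [integral_finsetSum _ fun i _ => integrable_indicator_acceptEvent D _ _]
  calc _ ≤ ∑ i ∈ Finset.range N, ε := ?_
    _ = _ := by rw [Finset.sum_const, Finset.card_range, nsmul_eq_mul]
  refine Finset.sum_le_sum fun i hi => ?_
  have hi := Finset.mem_range.1 hi
  rw [integral_indicator_one (measurableSet_acceptEvent D _ _)]
  refine tapeLaw_acceptEvent_le D hD (validFrom_windowOps hn hx (by omega))
    (by rw [length_windowOps]; omega) ?_
  rw [keySet_windowOps hn hx (by omega)]
  intro h
  obtain ⟨k, hk, hki⟩ := Finset.mem_image.1 h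
  have hk := Finset.mem_Ico.1 hk
  have := hx k (by omega) (i + n) (by omega) hki
  omega

/-- The space bound with explicit error terms. The parameter `R` is the number of shifts over
which the sliding window process is averaged. -/
theorem IsDynamicFilter.space_bound {ε : ℝ} {T R : ℕ} {D : Algorithm u h}
    (hD : IsDynamicFilter D n ε T) (hε : 0 < ε) (hε1 : ε ≤ 1) (hn : 0 < n) (hR : 0 < R)
    (hu : R + 3 * n ≤ u) (hT : n + 2 * (R + 2 * n) ≤ T) :
    n * ε * ((R + 2 * n) / R) * Real.log ε - ∑ j ∈ Finset.range n,
        Real.log ((((n : ℝ) - j) / n + ε) * ((R + 2 * n) / R * (ε * u + n))) ≤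
      h * Real.log 2 + (R + 3 * n : ℕ) * Real.log u - n * Real.log u -
        Real.log (u.descFactorial (R + 3 * n)) := by
  have hn' : (0 : ℝ) < n := by exact_mod_cast hn
  have hR' : (0 : ℝ) < R := by exact_mod_cast hR
  obtain ⟨L, hL⟩ : ∃ L, L = R + 3 * n := ⟨_, rfl⟩
  have : NeZero L := ⟨by omega⟩
  set B : ℝ := (R + 2 * n) / R * (ε * u + n) with hBdef
  have hB : 0 < B := by positivity
  set E : Finset (Fin L → Fin u) :=
    Finset.univ.image (fun (e : Fin L ↪ Fin u) => (⇑e : Fin L → Fin u)) with hEdef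
  have hEcard : E.card = u.descFactorial L := by
    rw [hEdef, Finset.card_image_of_injective _ fun _ _ h => DFunLike.coe_injective h,
      Finset.card_univ,
      Fintype.card_embedding_eq, Fintype.card_fin, Fintype.card_fin]
  have hEpos : 0 < E.card := by
    rw [hEcard, Nat.descFactorial_pos]
    omega
  have hEpos' : (0 : ℝ) < E.card := by exact_mod_cast hEpos
  have hinj : ∀ w ∈ E, ∀ j < R + 2 * n + n, ∀ k < R + 2 * n + n,
      extend w j = extend w k → j = k := by
    intro w hw j hj k hk hjk
    obtain ⟨e, -, rfl⟩ := Finset.mem_image.1 hw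
    exact (ofNat_injOn (L := L) (by omega) (by omega)).1 (e.injective hjk)
  set f : Tape → ℝ := fun t => ∑ w ∈ E,
    (n * earlyTotal (D.insertKey t) (D.deleteKey t) (D.query t) n (R + 2 * n) (D.create t)
      (extend w) * (-Real.log ε) +
    n * acceptedTotal (D.insertKey t) (D.deleteKey t) (D.query t) n (R + 2 * n) (D.create t)
      (extend w) / B) with hf
  have hlog : 0 ≤ -Real.log ε := by
    have := Real.log_nonpos hε.le hε1
    linarith
  have hint1 : ∀ w ∈ E, Integrable (fun t => (n : ℝ) * earlyTotal (D.insertKey t)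
      (D.deleteKey t) (D.query t) n (R + 2 * n) (D.create t) (extend w) * (-Real.log ε))
      tapeLaw := fun w _ => ((integrable_earlyTotal D n _ _).const_mul _).mul_const _
  have hint2 : ∀ w ∈ E, Integrable (fun t => (n : ℝ) * acceptedTotal (D.insertKey t)
      (D.deleteKey t) (D.query t) n (R + 2 * n) (D.create t) (extend w) / B)
      tapeLaw := fun w _ => ((integrable_acceptedTotal D n _ _).const_mul _).div_const _
  -- a tape that is at least as good as the average
  obtain ⟨t, ht⟩ := exists_le_integral (μ := tapeLaw) (f := f)
    (integrable_finsetSum _ fun w hw => (hint1 w hw).add (hint2 w hw))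
  have hfle : f t ≤ E.card * (n * ε * (R + 2 * n) * (-Real.log ε) + n * R) := by
    refine ht.trans ?_
    refine ((integral_finsetSum E fun w hw => (hint1 w hw).add (hint2 w hw)).trans
      (Finset.sum_congr rfl fun w hw => integral_add (hint1 w hw) (hint2 w hw))).le.trans ?_
    rw [← nsmul_eq_mul, ← Finset.sum_const]
    refine Finset.sum_le_sum fun w hw => ?_
    rw [integral_mul_const, integral_const_mul,
      integral_div, integral_const_mul]
    have h1 := integral_earlyTotal_le D hD hn (hinj w hw) hT
    have h2 := integral_acceptedTotal_le D hε.le hD hn (hinj w hw) hT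
    push_cast at h1 h2
    refine add_le_add ?_ ?_
    · refine mul_le_mul_of_nonneg_right ?_ hlog
      calc _ ≤ (n : ℝ) * ((R + 2 * n) * ε) := mul_le_mul_of_nonneg_left h1 hn'.le
        _ = _ := by ring
    · rw [div_le_iff₀ hB]
      calc _ ≤ (n : ℝ) * ((R + 2 * n) * (ε * u + n)) := mul_le_mul_of_nonneg_left h2 hn'.le
        _ = _ := by rw [hBdef]; field_simp
  have hmain := le_log_card (D.insertKey t) (D.deleteKey t) (D.query t) hε hε1 hB hL (D.create t)
    E (Finset.card_pos.1 hEpos) ?_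
  · have hsum : ∑ w ∈ E, (n * earlyTotal (D.insertKey t) (D.deleteKey t) (D.query t) n
        (R + 2 * n) (D.create t) (extend w) * Real.log ε -
        n * acceptedTotal (D.insertKey t) (D.deleteKey t) (D.query t) n (R + 2 * n) (D.create t)
          (extend w) / B) = - f t := by
      rw [hf, ← Finset.sum_neg_distrib]
      refine Finset.sum_congr rfl fun w _ => ?_
      ring
    rw [hsum] at hmain
    have hcard : Real.log (Fintype.card (Memory h)) = h * Real.log 2 := by
      simp [Real.log_pow]
    rw [hcard, Fintype.card_fin, hEcard] at hmain
    rw [hEcard] at hfle hEpos'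
    rw [← hL]
    have h3 : (R : ℝ) * (u.descFactorial L) * (n * ε * ((R + 2 * n) / R) * Real.log ε
        - ∑ j ∈ Finset.range n, Real.log ((((n : ℝ) - j) / n + ε) * B)) ≤
      R * (u.descFactorial L) * (h * Real.log 2 + L * Real.log u - n * Real.log u -
        Real.log (u.descFactorial L)) := by
      refine le_trans ?_ hmain
      have h4 : (R : ℝ) * (u.descFactorial L) * (n * ε * ((R + 2 * n) / R) * Real.log ε) =
          (u.descFactorial L) * (n * ε * (R + 2 * n) * Real.log ε) := by field_simp
      rw [mul_sub, h4]
      linarith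
    exact le_of_mul_le_mul_left h3 (by positivity)
  · intro w hw i hi k hk hk'
    rw [← run_windowOps]
    have hi' : i + n ≤ R + 2 * n + n := by omega
    refine hD.query_present _ (validFrom_windowOps hn (hinj w hw) hi')
      (by rw [length_windowOps]; omega) _ ?_ t
    rw [keySet_windowOps hn (hinj w hw) hi']
    exact Finset.mem_image_of_mem _ (Finset.mem_Ico.2 ⟨hk, hk'⟩)

end Ops

/-! ### Sums of logarithms -/

theorem sum_log_add_le {a : ℝ} (ha : 0 < a) (n : ℕ) :
    ∑ i ∈ Finset.range n, Real.log (a + i) ≤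
      ((a + n) * Real.log (a + n) - (a + n)) - (a * Real.log a - a) := by
  induction n with
  | zero => simp
  | succ n ih =>
    rw [Finset.sum_range_succ]
    have hx : 0 < a + n := by positivity
    set x := a + n with hxdef
    have h1 : Real.log (x / (x + 1)) ≤ x / (x + 1) - 1 :=
      Real.log_le_sub_one_of_pos (by positivity)
    rw [Real.log_div hx.ne' (by positivity)] at h1
    have h2 : (x + 1) * (Real.log x - Real.log (x + 1)) ≤ -1 := by
      calc _ ≤ (x + 1) * (x / (x + 1) - 1) := mul_le_mul_of_nonneg_left h1 (by positivity)
        _ = -1 := by field_simp; ring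
    have h3 : a + ((n + 1 : ℕ) : ℝ) = x + 1 := by push_cast; ring
    rw [h3]
    linarith

/-- The excess of `∫₀¹ log (x + c) dx` over its value `-1` at `c = 0`. -/
noncomputable def logExcess (c : ℝ) : ℝ := Real.negMulLog c - Real.negMulLog (1 + c)

theorem tendsto_logExcess {ι : Type*} {l : Filter ι} {f : ι → ℝ} (hf : Tendsto f l (nhds 0)) :
    Tendsto (fun i => logExcess (f i)) l (nhds 0) := by
  have hc : Continuous logExcess := by
    unfold logExcess
    exact Real.continuous_negMulLog.sub
      (Real.continuous_negMulLog.comp (continuous_const.add continuous_id))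
  have h0 : logExcess 0 = 0 := by simp [logExcess]
  have := (hc.tendsto 0).comp hf
  rwa [h0] at this

theorem sum_log_fraction_le {c : ℝ} (hc : 0 ≤ c) {n : ℕ} (hn : 0 < n) :
    ∑ j ∈ Finset.range n, Real.log (((n : ℝ) - j) / n + c) ≤
      n * (logExcess (c + 1 / n) - 1) := by
  have hn' : (0 : ℝ) < n := by exact_mod_cast hn
  have ha : 0 < 1 + c * n := by positivity
  have h1 : ∑ j ∈ Finset.range n, Real.log (((n : ℝ) - j) / n + c) =
      ∑ i ∈ Finset.range n, (Real.log (1 + c * n + i) - Real.log n) := by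
    rw [← Finset.sum_range_reflect]
    refine Finset.sum_congr rfl fun i hi => ?_
    have hi := Finset.mem_range.1 hi
    rw [← Real.log_div (by positivity) hn'.ne']
    congr 1
    rw [Nat.cast_sub (by omega), Nat.cast_sub (by omega)]
    field_simp
    push_cast
    ring
  rw [h1, Finset.sum_sub_distrib, Finset.sum_const, Finset.card_range, nsmul_eq_mul]
  have h2 := sum_log_add_le ha n
  have e1 : 1 + c * n = n * (c + 1 / n) := by field_simp; ring
  have e2 : 1 + c * n + n = n * (1 + (c + 1 / n)) := by field_simp; ring
  have hc' : 0 < c + 1 / n := by positivity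
  have l1 : Real.log (1 + c * n) = Real.log n + Real.log (c + 1 / n) := by
    rw [e1, Real.log_mul hn'.ne' hc'.ne']
  have l2 : Real.log (1 + c * n + n) = Real.log n + Real.log (1 + (c + 1 / n)) := by
    rw [e2, Real.log_mul hn'.ne' (by positivity)]
  rw [l1, l2, e2] at h2
  rw [e1] at h2 ⊢
  unfold logExcess Real.negMulLog
  linarith

theorem log_factorial_le {n : ℕ} (hn : 0 < n) :
    Real.log n.factorial ≤ n * Real.log n + n * (logExcess (1 / n) - 1) := by
  have hn' : (0 : ℝ) < n := by exact_mod_cast hn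
  have h := sum_log_fraction_le le_rfl hn
  rw [zero_add] at h
  have h1 : ∑ j ∈ Finset.range n, Real.log (((n : ℝ) - j) / n + 0) =
      Real.log n.factorial - n * Real.log n := by
    rw [← Finset.prod_range_add_one_eq_factorial, Nat.cast_prod, Real.log_prod fun i _ => by
      positivity, ← Finset.sum_range_reflect, ← nsmul_eq_mul]
    conv_rhs => rw [← Finset.card_range n, ← Finset.sum_const, Finset.card_range]
    rw [← Finset.sum_sub_distrib]
    refine Finset.sum_congr rfl fun i hi => ?_
    have hi := Finset.mem_range.1 hi
    rw [add_zero, ← Real.log_div (by positivity) hn'.ne']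
    congr 2
    rw [Nat.cast_sub (by omega), Nat.cast_sub (by omega)]
    push_cast
    ring
  linarith

theorem le_log_factorial {n : ℕ} (hn : 0 < n) :
    n * Real.log n - n ≤ Real.log n.factorial := by
  have hn' : (0 : ℝ) < n := by exact_mod_cast hn
  have hf : (0 : ℝ) < n.factorial := by exact_mod_cast n.factorial_pos
  have h := Real.pow_div_factorial_le_exp (n : ℝ) hn'.le n
  have h1 := Real.log_le_log (by positivity) h
  rw [Real.log_exp, Real.log_div (by positivity) hf.ne', Real.log_pow] at h1
  linarith

/-! ### The number of fingerprint sets -/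

theorem log_choose_le {ε : ℝ} (hε : 0 < ε) (hε1 : ε < 1) {n : ℕ} (hn : 0 < n) :
    Real.log (Nat.choose ⌊(n : ℝ) * ε⁻¹⌋₊ n) ≤ n * Real.log ε⁻¹ + n := by
  have hn' : (0 : ℝ) < n := by exact_mod_cast hn
  have hf : (0 : ℝ) < n.factorial := by exact_mod_cast n.factorial_pos
  have hnm : n ≤ ⌊(n : ℝ) * ε⁻¹⌋₊ :=
    Nat.le_floor (le_mul_of_one_le_right hn'.le (one_le_inv_iff₀.2 ⟨hε, hε1.le⟩))
  have hpos : (0 : ℝ) < Nat.choose ⌊(n : ℝ) * ε⁻¹⌋₊ n := by exact_mod_cast Nat.choose_pos hnm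
  have h1 : (Nat.choose ⌊(n : ℝ) * ε⁻¹⌋₊ n : ℝ) ≤ ((n : ℝ) * ε⁻¹) ^ n / n.factorial := by
    refine (Nat.choose_le_pow_div _ _).trans ?_
    gcongr
    exact Nat.floor_le (by positivity)
  have h2 := Real.log_le_log hpos h1
  rw [Real.log_div (by positivity) hf.ne', Real.log_pow, Real.log_mul hn'.ne' (by positivity)]
    at h2
  have h3 := le_log_factorial hn
  linarith

theorem le_log_choose {ε : ℝ} (hε : 0 < ε) (hε1 : ε < 1) {n : ℕ} (hn : 0 < n) :
    n * Real.log ε⁻¹ + n - n * (logExcess (1 / n) - Real.log (1 - ε)) ≤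
      Real.log (Nat.choose ⌊(n : ℝ) * ε⁻¹⌋₊ n) := by
  have hn' : (0 : ℝ) < n := by exact_mod_cast hn
  have hf : (0 : ℝ) < n.factorial := by exact_mod_cast n.factorial_pos
  set m := ⌊(n : ℝ) * ε⁻¹⌋₊ with hm
  have hnm : n ≤ m :=
    Nat.le_floor (le_mul_of_one_le_right hn'.le (one_le_inv_iff₀.2 ⟨hε, hε1.le⟩))
  have hε' : 0 < 1 - ε := by linarith
  have h0 : (n : ℝ) * ε⁻¹ * (1 - ε) ≤ (m + 1 - n : ℕ) := by
    rw [Nat.cast_sub (by omega)]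
    push_cast
    have := Nat.lt_floor_add_one ((n : ℝ) * ε⁻¹)
    rw [← hm] at this
    have e : (n : ℝ) * ε⁻¹ * (1 - ε) = n * ε⁻¹ - n := by field_simp
    linarith
  have h1 : ((n : ℝ) * ε⁻¹ * (1 - ε)) ^ n ≤ m.choose n * n.factorial := by
    calc _ ≤ ((m + 1 - n : ℕ) : ℝ) ^ n := by gcongr
      _ ≤ (m.descFactorial n : ℝ) := by exact_mod_cast Nat.pow_sub_le_descFactorial m n
      _ = _ := by rw [Nat.descFactorial_eq_factorial_mul_choose]; push_cast; ring
  have hpos : (0 : ℝ) < m.choose n := by exact_mod_cast Nat.choose_pos hnm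
  have h2 := Real.log_le_log (by positivity) h1
  rw [Real.log_pow, Real.log_mul (by positivity) hε'.ne', Real.log_mul hn'.ne' (by positivity),
    Real.log_mul hpos.ne' hf.ne'] at h2
  have h3 := log_factorial_le hn
  linarith

/-! ### The asymptotic bounds -/

/-- The relative error, in nats per key, of the space bound that uses `K * n` shifts. -/
noncomputable def spaceError (ε : ℝ) (n u K : ℕ) : ℝ :=
  logExcess (ε + 1 / n) + Real.log (1 + 2 / K) + Real.log (1 + n * ε⁻¹ / u) -
    (K + 3) * Real.log (1 - (K + 3) * (n / u)) - (1 + 2 / K) * (ε * Real.log ε)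

theorem IsDynamicFilter.le_space {u h : ℕ} {D : Algorithm u h} {n T K : ℕ} {ε : ℝ}
    (hD : IsDynamicFilter D n ε T) (hε : 0 < ε) (hε1 : ε ≤ 1) (hn : 0 < n) (hK : 0 < K)
    (hu : (K + 3) * n < u) (hT : (2 * K + 5) * n ≤ T) :
    n * Real.log ε⁻¹ + n - n * spaceError ε n u K ≤ h * Real.log 2 := by
  have hn' : (0 : ℝ) < n := by exact_mod_cast hn
  have hK' : (0 : ℝ) < K := by exact_mod_cast hK
  have hu' : (0 : ℝ) < u := by exact_mod_cast (show 0 < u by omega)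
  have hue : ((K : ℝ) + 3) * n < u := by exact_mod_cast hu
  have h := hD.space_bound (R := K * n) hε hε1 hn (by positivity) (by linarith) (by linarith)
  have er : (((K * n : ℕ) : ℝ) + 2 * n) / (K * n : ℕ) = 1 + 2 / K := by
    push_cast
    field_simp
  rw [er] at h
  have hr : 0 < 1 + 2 / (K : ℝ) := by positivity
  -- the universe is so large that its size may be compared with falling factorials
  have hL : ((K * n + 3 * n : ℕ) : ℝ) = (K + 3) * n := by push_cast; ring
  have hq : 0 < 1 - ((K : ℝ) + 3) * (n / u) := by
    rw [sub_pos, ← mul_div_assoc, div_lt_one hu']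
    exact hue
  have hdesc : ((K : ℝ) + 3) * n * (Real.log u + Real.log (1 - (K + 3) * (n / u))) ≤
      Real.log (u.descFactorial (K * n + 3 * n)) := by
    have h1 : ((u : ℝ) * (1 - (K + 3) * (n / u))) ^ (K * n + 3 * n) ≤
        u.descFactorial (K * n + 3 * n) := by
      calc _ ≤ ((u + 1 - (K * n + 3 * n) : ℕ) : ℝ) ^ (K * n + 3 * n) := by
            gcongr
            rw [Nat.cast_sub (by linarith), hL]
            push_cast
            field_simp
            linarith
        _ ≤ _ := by exact_mod_cast Nat.pow_sub_le_descFactorial u _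
    have h2 := Real.log_le_log (by positivity) h1
    rwa [Real.log_pow, hL, Real.log_mul hu'.ne' hq.ne'] at h2
  have hB : 0 < (1 + 2 / (K : ℝ)) * (ε * u + n) := by positivity
  have hlogB : Real.log ((1 + 2 / (K : ℝ)) * (ε * u + n)) =
      Real.log (1 + 2 / K) + (Real.log ε + Real.log u + Real.log (1 + n * ε⁻¹ / u)) := by
    have e : ε * u + n = ε * u * (1 + n * ε⁻¹ / u) := by field_simp
    rw [Real.log_mul hr.ne' (by positivity), e, Real.log_mul (by positivity) (by positivity),
      Real.log_mul hε.ne' hu'.ne']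
  have hsum : ∑ j ∈ Finset.range n, Real.log ((((n : ℝ) - j) / n + ε) *
      ((1 + 2 / (K : ℝ)) * (ε * u + n))) =
      ∑ j ∈ Finset.range n, Real.log (((n : ℝ) - j) / n + ε) +
        n * Real.log ((1 + 2 / (K : ℝ)) * (ε * u + n)) := by
    rw [← nsmul_eq_mul]
    conv_rhs => rw [← Finset.card_range n, ← Finset.sum_const, Finset.card_range]
    rw [← Finset.sum_add_distrib]
    refine Finset.sum_congr rfl fun j hj => Real.log_mul ?_ hB.ne'
    have : (j : ℝ) < n := by exact_mod_cast Finset.mem_range.1 hj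
    have h1 : (0 : ℝ) ≤ ((n : ℝ) - j) / n := div_nonneg (by linarith) hn'.le
    positivity
  rw [hsum, hlogB, hL] at h
  have hs := sum_log_fraction_le hε.le hn
  rw [Real.log_inv]
  unfold spaceError
  linarith

section Limits

variable {ε : ℕ → ℝ} {u T : ℕ → ℕ}

theorem tendsto_spaceError (hε : Tendsto ε atTop (nhds 0)) (hε_mem : ∀ n, ε n ∈ Set.Ioo (0 : ℝ) 1)
    (hu : Tendsto (fun n : ℕ => (n : ℝ) * (ε n)⁻¹ / u n) atTop (nhds 0)) (K : ℕ) :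
    Tendsto (fun n => spaceError (ε n) n (u n) K) atTop (nhds (Real.log (1 + 2 / K))) := by
  have h1 : Tendsto (fun n : ℕ => logExcess (ε n + 1 / n)) atTop (nhds 0) := by
    refine tendsto_logExcess ?_
    simpa using hε.add tendsto_one_div_atTop_nhds_zero_nat
  have h2 : Tendsto (fun n : ℕ => Real.log (1 + n * (ε n)⁻¹ / u n)) atTop (nhds 0) := by
    have := (hu.const_add 1).log (by norm_num)
    simpa using this
  have h3 : Tendsto (fun n : ℕ => (n : ℝ) / u n) atTop (nhds 0) := by
    have := hu.mul hε
    rw [mul_zero] at this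
    refine this.congr fun n => ?_
    have := (hε_mem n).1.ne'
    field_simp
  have h4 : Tendsto (fun n : ℕ => ((K : ℝ) + 3) * Real.log (1 - (K + 3) * (n / u n))) atTop
      (nhds 0) := by
    have := (((h3.const_mul ((K : ℝ) + 3)).const_sub 1).log (by simp)).const_mul ((K : ℝ) + 3)
    simpa using this
  have h5 : Tendsto (fun n => (1 + 2 / (K : ℝ)) * (ε n * Real.log (ε n))) atTop (nhds 0) := by
    have := ((Real.continuous_mul_log.tendsto 0).comp hε).const_mul (1 + 2 / (K : ℝ))
    simpa using this
  have := (((h1.add (tendsto_const_nhds (x := Real.log (1 + 2 / K)))).add h2).sub h4).sub h5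
  simpa [spaceError] using this

theorem eventually_le_space (hε_mem : ∀ n, ε n ∈ Set.Ioo (0 : ℝ) 1)
    (hε : ε =o[atTop] fun _ => (1 : ℝ))
    (hu : (fun n : ℕ => (n : ℝ) * (ε n)⁻¹) =o[atTop] fun n => (u n : ℝ))
    (hT : (fun n : ℕ => (n : ℝ)) =o[atTop] fun n => (T n : ℝ)) {η : ℝ} (hη : 0 < η) :
    ∀ᶠ n in atTop, ∀ (h : ℕ) (D : Algorithm (u n) h), IsDynamicFilter D n (ε n) (T n) →
      n * Real.log (ε n)⁻¹ + n - η * n ≤ h * Real.log 2 := by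
  obtain ⟨K, hK⟩ := exists_nat_gt (2 / η)
  have hK0 : (0 : ℝ) < K := (by positivity : 0 < 2 / η).trans hK
  have hK0' : 0 < K := by exact_mod_cast hK0
  have hKη : Real.log (1 + 2 / K) < η := by
    have h1 : Real.log (1 + 2 / K) ≤ 1 + 2 / (K : ℝ) - 1 :=
      Real.log_le_sub_one_of_pos (by positivity)
    have h2 : 2 / (K : ℝ) < η := by
      rw [div_lt_iff₀ hK0]
      rw [div_lt_iff₀ hη] at hK
      linarith
    linarith
  have hlim := tendsto_spaceError ((isLittleO_one_iff ℝ).1 hε) hε_mem hu.tendsto_div_nhds_zero K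
  have hc1 : (0 : ℝ) < 1 / (K + 4) := by positivity
  have hc2 : (0 : ℝ) < 1 / (2 * K + 5) := by positivity
  filter_upwards [hlim.eventually_lt_const hKη, hu.bound hc1, hT.bound hc2, eventually_gt_atTop 0]
    with n h1 h2 h3 hn h D hD
  obtain ⟨hε0, hε1⟩ := hε_mem n
  have hn' : (0 : ℝ) < n := by exact_mod_cast hn
  rw [Real.norm_of_nonneg (by positivity), Real.norm_of_nonneg (by positivity),
    one_div_mul_eq_div, le_div_iff₀ (by positivity)] at h2 h3
  have h4 : (n : ℝ) ≤ n * (ε n)⁻¹ :=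
    le_mul_of_one_le_right hn'.le (one_le_inv_iff₀.2 ⟨hε0, hε1.le⟩)
  have h5 : (K + 3) * n < u n := by
    have : ((K : ℝ) + 3) * n < u n := by nlinarith
    exact_mod_cast this
  have h6 : (2 * K + 5) * n ≤ T n := by
    have : (2 * (K : ℝ) + 5) * n ≤ T n := by linarith
    exact_mod_cast this
  have h7 := hD.le_space hε0 hε1.le hn hK0' h5 h6
  have h8 := mul_le_mul_of_nonneg_left h1.le hn'.le
  linarith

theorem log_two_mul_bound (x y : ℝ) :
    (x * Real.logb 2 y + x * Real.logb 2 (Real.exp 1)) * Real.log 2 = x * Real.log y + x := by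
  have : Real.log 2 ≠ 0 := (Real.log_pos one_lt_two).ne'
  unfold Real.logb
  rw [Real.log_exp]
  field_simp

theorem exists_space_error (hε_mem : ∀ n, ε n ∈ Set.Ioo (0 : ℝ) 1)
    (hε : ε =o[atTop] fun _ => (1 : ℝ))
    (hu : (fun n : ℕ => (n : ℝ) * (ε n)⁻¹) =o[atTop] fun n => (u n : ℝ))
    (hT : (fun n : ℕ => (n : ℝ)) =o[atTop] fun n => (T n : ℝ)) :
    ∃ err : ℕ → ℝ, err =o[atTop] (fun n : ℕ => (n : ℝ)) ∧
      ∀ (n h : ℕ) (D : Algorithm (u n) h), IsDynamicFilter D n (ε n) (T n) →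
        (n : ℝ) * Real.logb 2 (ε n)⁻¹ + (n : ℝ) * Real.logb 2 (Real.exp 1) - err n ≤ (h : ℝ) := by
  classical
  -- the error is the exact deficit of the smallest filter, or `0` where there is no filter
  let P : ℕ → ℕ → Prop := fun n h => ∃ D : Algorithm (u n) h, IsDynamicFilter D n (ε n) (T n)
  let bound : ℕ → ℝ := fun n =>
    (n : ℝ) * Real.logb 2 (ε n)⁻¹ + (n : ℝ) * Real.logb 2 (Real.exp 1)
  refine ⟨fun n => if hP : ∃ h, P n h then max 0 (bound n - Nat.find hP) else 0, ?_, ?_⟩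
  · have hlog : 0 < Real.log 2 := Real.log_pos one_lt_two
    refine isLittleO_iff.2 fun c hc => ?_
    filter_upwards [eventually_le_space hε_mem hε hu hT (mul_pos hc hlog)] with n hn
    rw [Real.norm_of_nonneg (Nat.cast_nonneg n)]
    split_ifs with hP
    · obtain ⟨D, hD⟩ := Nat.find_spec hP
      have h1 := hn _ D hD
      rw [Real.norm_of_nonneg (le_max_left _ _)]
      refine max_le (by positivity) (le_of_mul_le_mul_right ?_ hlog)
      rw [sub_mul, log_two_mul_bound]
      linarith
    · rw [norm_zero]
      positivity
  · intro n h D hD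
    have hP : ∃ h, P n h := ⟨h, D, hD⟩
    beta_reduce
    rw [dif_pos hP]
    have h1 : (Nat.find hP : ℝ) ≤ h := by exact_mod_cast Nat.find_min' hP ⟨D, hD⟩
    have h2 := le_max_right 0 (bound n - Nat.find hP)
    change bound n - _ ≤ _
    linarith

theorem isLittleO_logb_choose (hε_mem : ∀ n, ε n ∈ Set.Ioo (0 : ℝ) 1)
    (hε : ε =o[atTop] fun _ => (1 : ℝ)) :
    (fun n : ℕ => Real.logb 2 (Nat.choose ⌊(n : ℝ) * (ε n)⁻¹⌋₊ n : ℝ) -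
        ((n : ℝ) * Real.logb 2 (ε n)⁻¹ + (n : ℝ) * Real.logb 2 (Real.exp 1)))
      =o[atTop] (fun n : ℕ => (n : ℝ)) := by
  have hlog : 0 < Real.log 2 := Real.log_pos one_lt_two
  have hlim : Tendsto (fun n : ℕ => logExcess (1 / n) - Real.log (1 - ε n)) atTop (nhds 0) := by
    have h1 := tendsto_logExcess (tendsto_one_div_atTop_nhds_zero_nat (𝕜 := ℝ))
    have h2 := (((isLittleO_one_iff ℝ).1 hε).const_sub 1).log (by norm_num)
    simpa using h1.sub h2
  refine isLittleO_iff.2 fun c hc => ?_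
  filter_upwards [hlim.eventually_lt_const (mul_pos hc hlog), eventually_gt_atTop 0] with n h1 hn
  obtain ⟨hε0, hε1⟩ := hε_mem n
  have hn' : (0 : ℝ) < n := by exact_mod_cast hn
  rw [Real.norm_of_nonneg hn'.le, Real.norm_eq_abs]
  refine le_of_mul_le_mul_right ?_ hlog
  rw [← abs_of_pos hlog, ← abs_mul, abs_of_pos hlog, sub_mul, log_two_mul_bound, Real.logb,
    div_mul_cancel₀ _ hlog.ne', abs_le]
  have h2 := log_choose_le hε0 hε1 hn
  have h3 := le_log_choose hε0 hε1 hn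
  have h4 := mul_le_mul_of_nonneg_left h1.le hn'.le
  have h5 : 0 ≤ c * n * Real.log 2 := by positivity
  constructor <;> linarith

end Limits

end DynFilter

theorem theorem1
    -- the parameters, as functions of the capacity `n`: the false-positive rate, the size of the
    -- universe, and the number of insertions and deletions that are supported
    (ε : ℕ → ℝ) (u T : ℕ → ℕ)
    (hε_mem : ∀ n, ε n ∈ Set.Ioo (0 : ℝ) 1)
    (hε : ε =o[atTop] fun _ => (1 : ℝ))
    (hu : (fun n : ℕ => (n : ℝ) * (ε n)⁻¹) =o[atTop] fun n => (u n : ℝ))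
    (hT : (fun n : ℕ => (n : ℝ)) =o[atTop] fun n => (T n : ℝ)) :
    -- the space bound, with an error term that does not depend on the filter
    (∃ err : ℕ → ℝ, err =o[atTop] (fun n : ℕ => (n : ℝ)) ∧
      ∀ (n h : ℕ) (D : DynFilter.Algorithm (u n) h), DynFilter.IsDynamicFilter D n (ε n) (T n) →
        (n : ℝ) * Real.logb 2 (ε n)⁻¹ + (n : ℝ) * Real.logb 2 (Real.exp 1) - err n ≤ (h : ℝ)) ∧
    -- the bound agrees, up to `o(n)`, with the space that fingerprint filters require
    (fun n : ℕ => Real.logb 2 (Nat.choose ⌊(n : ℝ) * (ε n)⁻¹⌋₊ n : ℝ) -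
        ((n : ℝ) * Real.logb 2 (ε n)⁻¹ + (n : ℝ) * Real.logb 2 (Real.exp 1)))
      =o[atTop] (fun n : ℕ => (n : ℝ)) :=
  ⟨DynFilter.exists_space_error hε_mem hε hu hT, DynFilter.isLittleO_logb_choose hε_mem hε⟩
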